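/- Let $F$ be a field of characteristic $p \ge 0$, let $G$ be a group, let $FG$ be the group algebra, and let $V(FG)$ be the group of normalized units of $FG$, that is, of the units $\sum_{g} a_g g$ with $\sum_g a_g = 1$. For elements of a group put $(x,y) = x^{-1}y^{-1}xy$ and $(x_1,\dots,x_n) = ((x_1,\dots,x_{n-1}),x_n)$. A group is called Engel if for any two of its elements $x, y$ one has $(x,y,\dots,y)=1$ when $y$ is repeated sufficiently many times, depending on $x$ and $y$. Suppose that $FG$ has at least one, but only finitely many, nonzero nilpotent elements. Then $F$ is a finite field (so that $p$ is a prime). If, moreover, $V(FG)$ is an Engel group, then $V(FG)$ is nilpotent, $G$ is finite, and $G$ has a unique Sylow $p$-subgroup $\mathrm{Syl}_p(G)$; it satisfies $\mathrm{Syl}_p(G) \neq \langle 1\rangle$ and $G' \le \mathrm{Syl}_p(G)$, and $G = \mathrm{Syl}_p(G) \times A$ (internal direct product) for some central subgroup $A$ of $G$. -/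

import Mathlib

/-- The augmentation map of the group algebra `F[G]`: the `F`-algebra homomorphism to `F` that
sends every element of `G` to `1`, i.e. `∑ a_g g ↦ ∑ a_g`. -/
noncomputable def augmentation (F G : Type*) [Field F] [Group G] : MonoidAlgebra F G →ₐ[F] F :=
  MonoidAlgebra.lift F F G (1 : G →* F)

/-- `V(FG)`: the group of normalized units of `F[G]`, i.e. the units of augmentation `1`. -/
noncomputable def normalizedUnits (F G : Type*) [Field F] [Group G] :
    Subgroup (MonoidAlgebra F G)ˣ :=
  (Units.map (augmentation F G : MonoidAlgebra F G →* F)).ker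

/-- The left-normed commutator `(x, y, …, y)` with `n` copies of `y`, where
`(a, b) = a⁻¹ b⁻¹ a b`. -/
def engelCommutator {H : Type*} [Group H] (x y : H) : ℕ → H
  | 0 => x
  | n + 1 => (engelCommutator x y n)⁻¹ * y⁻¹ * engelCommutator x y n * y

/-- Engel groups: for all `x`, `y` one has `(x, y, …, y) = 1` for sufficiently many copies of `y`,
depending on `x` and `y`. -/
def IsEngelGroup (H : Type*) [Group H] : Prop :=
  ∀ x y : H, ∃ n : ℕ, 1 ≤ n ∧ engelCommutator x y n = 1

/-!
Scalar multiples of a nonzero nilpotent `x` are nilpotent, so `F` is finite. Conjugates of `x`, and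
products of `x` with elements of `G` centralizing it, are nilpotent too, and a nonzero element of
`F[G]` has finite support, so `G` is finite (`finite_group_of_finite_nilpotents`). The Engel
condition is not needed for this.

Let now `V(F[G])` be Engel, and let `J` be the Jacobson radical of the finite ring `F[G]`. The full
unit group is Engel, since it is `V(F[G])` times central scalars, and units lift modulo `J`, so the
unit group of `F[G] / J` is Engel. This ring is a product of matrix rings over finite fields. A
`2 × 2` block would contain units with `y⁻¹ x y = x⁻¹` and `x` not of order a power of two, which an
Engel group forbids (`IsEngelGroup.exists_pow_two_pow_eq_one`). So `F[G] / J` is commutative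
and reduced. Consequently `{g | g - 1 ∈ J}` is a normal Sylow `p`-subgroup `P` containing `G'`
(`sylow_eq_ker_toQuotientJacobson`). Its Schur–Zassenhaus complement `A` is central, because in an
Engel group `p`-elements of a normal `p`-subgroup commute with elements of order prime to `p`
(`IsEngelGroup.commute_of_mem_normal_of_coprime`). If `P` were trivial, `F[G]` would be commutative
and semisimple, hence without nonzero nilpotents.

Finally `F[G] = F[A] + J` with `F[A]` central and `J` nil, so every `u` has a central power
`u ^ p ^ k`. Thus `V(F[G])` modulo its center is a finite `p`-group, and `V(F[G])` is nilpotent.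
-/

/-! ### Engel groups -/

section Engel

variable {H K : Type*} [Group H] [Group K]

theorem map_engelCommutator (f : H →* K) (x y : H) (n : ℕ) :
    f (engelCommutator x y n) = engelCommutator (f x) (f y) n := by
  induction n with
  | zero => rfl
  | succ n ih => simp [engelCommutator, ih]

theorem IsEngelGroup.of_surjective (hH : IsEngelGroup H) (f : H →* K)
    (hf : Function.Surjective f) : IsEngelGroup K := by
  intro x y
  obtain ⟨x, rfl⟩ := hf x
  obtain ⟨y, rfl⟩ := hf y
  obtain ⟨n, hn, h⟩ := hH x y
  exact ⟨n, hn, by rw [← map_engelCommutator, h, map_one]⟩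

theorem IsEngelGroup.of_injective (hK : IsEngelGroup K) (f : H →* K)
    (hf : Function.Injective f) : IsEngelGroup H := by
  intro x y
  obtain ⟨n, hn, h⟩ := hK (f x) (f y)
  exact ⟨n, hn, hf (by rw [map_engelCommutator, h, map_one])⟩

theorem engelCommutator_mul_center {x y c d : H} (hc : c ∈ Subgroup.center H)
    (hd : d ∈ Subgroup.center H) (n : ℕ) :
    engelCommutator (x * c) (y * d) (n + 1) = engelCommutator x y (n + 1) := by
  have key : ∀ z : H, z⁻¹ * (y * d)⁻¹ * z * (y * d) = z⁻¹ * y⁻¹ * z * y := fun z => by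
    have hd' := Subgroup.mem_center_iff.mp hd
    calc z⁻¹ * (y * d)⁻¹ * z * (y * d) = z⁻¹ * d⁻¹ * (y⁻¹ * z * y * d) := by group
      _ = z⁻¹ * d⁻¹ * (d * (y⁻¹ * z * y)) := by rw [hd']
      _ = _ := by group
  induction n with
  | zero =>
    have hc' := Subgroup.mem_center_iff.mp hc
    simp only [engelCommutator, key]
    calc (x * c)⁻¹ * y⁻¹ * (x * c) * y = c⁻¹ * (x⁻¹ * y⁻¹ * x * (c * y)) := by group
      _ = c⁻¹ * (x⁻¹ * y⁻¹ * x * y * c) := by rw [← hc' y]; group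
      _ = c⁻¹ * (c * (x⁻¹ * y⁻¹ * x * y)) := by rw [hc' (x⁻¹ * y⁻¹ * x * y)]
      _ = _ := by group
  | succ n ih => rw [engelCommutator, ih, key]; rfl

/-- The Engel condition passes from a subgroup `N` to the whole group `H = N · Z(H)`. -/
theorem IsEngelGroup.of_forall_mul_center {N : Subgroup H} (hN : IsEngelGroup N)
    (h : ∀ g : H, ∃ c ∈ Subgroup.center H, g * c ∈ N) : IsEngelGroup H := by
  intro x y
  obtain ⟨c, hc, hx⟩ := h x
  obtain ⟨d, hd, hy⟩ := h y
  obtain ⟨n, hn, e⟩ := hN ⟨_, hx⟩ ⟨_, hy⟩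
  refine ⟨n, hn, ?_⟩
  have e' := congrArg N.subtype e
  rw [map_engelCommutator, map_one] at e'
  obtain ⟨m, rfl⟩ := Nat.exists_eq_add_of_le' hn
  exact (engelCommutator_mul_center hc hd m).symm.trans e'

/-- If `y` inverts `x`, commutation with `y` acts on the powers of `x` as raising to the power
`-2`, so in an Engel group the order of `x` is a power of two. -/
theorem IsEngelGroup.exists_pow_two_pow_eq_one (hH : IsEngelGroup H) {x y : H}
    (hxy : y⁻¹ * x * y = x⁻¹) : ∃ n : ℕ, x ^ 2 ^ n = 1 := by
  obtain ⟨n, -, hn⟩ := hH x y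
  have key : ∀ n : ℕ, engelCommutator x y n = x ^ ((-2 : ℤ) ^ n) := by
    intro n
    induction n with
    | zero => simp [engelCommutator]
    | succ n ih =>
      rw [engelCommutator, ih]
      have hc : y⁻¹ * x ^ ((-2 : ℤ) ^ n) * y = (x⁻¹) ^ ((-2 : ℤ) ^ n) := by
        have := conj_zpow (i := (-2 : ℤ) ^ n) (a := y⁻¹) (b := x)
        rw [inv_inv, hxy] at this
        exact this.symm
      calc _ = (x ^ ((-2 : ℤ) ^ n))⁻¹ * (y⁻¹ * x ^ ((-2 : ℤ) ^ n) * y) := by group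
        _ = _ := by rw [hc, inv_zpow, ← zpow_neg, ← zpow_add]; congr 1; ring
  refine ⟨n, ?_⟩
  rw [key, ← orderOf_dvd_iff_zpow_eq_one] at hn
  rw [← orderOf_dvd_iff_pow_eq_one]
  have : (orderOf x : ℤ) ∣ ((2 ^ n : ℕ) : ℤ) := by
    rw [← dvd_abs, abs_pow] at hn
    simpa using hn
  exact_mod_cast this

/-- In an Engel group, elements of a normal `p`-subgroup commute with elements of order prime to
`p`: a nontrivial last term `z = (w, a)` of the sequence `(x, a, …, a)` commutes with `a`, so
conjugation by `a ^ m` sends `w` to `w * z ^ m`, and `m = orderOf a` gives `z ^ m = 1`. -/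
theorem IsEngelGroup.commute_of_mem_normal_of_coprime (hH : IsEngelGroup H) {p : ℕ}
    {N : Subgroup H} [N.Normal] (hN : IsPGroup p N) {x a : H} (hx : x ∈ N)
    (ha : p.Coprime (orderOf a)) : Commute x a := by
  have hmem : ∀ n, engelCommutator x a n ∈ N := by
    intro n
    induction n with
    | zero => exact hx
    | succ n ih =>
      rw [engelCommutator, mul_assoc, mul_assoc]
      refine N.mul_mem (N.inv_mem ih) ?_
      rw [← mul_assoc]
      exact Subgroup.Normal.conj_mem' inferInstance _ ih a
  have down : ∀ n, engelCommutator x a (n + 2) = 1 → engelCommutator x a (n + 1) = 1 := by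
    intro n hn
    set w := engelCommutator x a n with hw
    set z := engelCommutator x a (n + 1) with hz
    have hza : a⁻¹ * z * a = z := by
      have : z⁻¹ * a⁻¹ * z * a = 1 := hn
      calc a⁻¹ * z * a = z * (z⁻¹ * a⁻¹ * z * a) := by group
        _ = z := by rw [this, mul_one]
    have hwa : a⁻¹ * w * a = w * z := by
      have : z = w⁻¹ * a⁻¹ * w * a := rfl
      rw [this]; group
    have hpow : ∀ m : ℕ, (a ^ m)⁻¹ * w * a ^ m = w * z ^ m := by
      intro m
      induction m with
      | zero => simp
      | succ m ih =>
        calc (a ^ (m + 1))⁻¹ * w * a ^ (m + 1) = a⁻¹ * ((a ^ m)⁻¹ * w * a ^ m) * a := by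
              rw [pow_succ]; group
          _ = (a⁻¹ * w * a) * (a⁻¹ * z ^ m * a) := by rw [ih]; group
          _ = w * z ^ (m + 1) := by
              have := conj_pow (i := m) (a := a⁻¹) (b := z)
              rw [inv_inv, hza] at this
              rw [hwa, ← this, pow_succ', mul_assoc]
    have h1 : z ^ orderOf a = 1 := by
      have := hpow (orderOf a)
      rw [pow_orderOf_eq_one] at this
      simpa using this
    obtain ⟨k, hk⟩ := hN ⟨z, hmem (n + 1)⟩
    have hk' : z ^ p ^ k = 1 := congrArg Subtype.val hk
    rw [← orderOf_eq_one_iff]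
    exact Nat.eq_one_of_dvd_coprimes (ha.pow_left k) (orderOf_dvd_of_pow_eq_one hk')
      (orderOf_dvd_of_pow_eq_one h1)
  have h1 : ∀ n, engelCommutator x a (n + 1) = 1 → engelCommutator x a 1 = 1 := by
    intro n
    induction n with
    | zero => exact id
    | succ n ih => exact fun h => ih (down n h)
  obtain ⟨n, hn, h⟩ := hH x a
  obtain ⟨m, rfl⟩ := Nat.exists_eq_add_of_le' hn
  have h2 : x⁻¹ * a⁻¹ * x * a = 1 := h1 m h
  calc x * a = a * x * (x⁻¹ * a⁻¹ * x * a) := by group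
    _ = a * x := by rw [h2, mul_one]

/-- A complement of the normal Sylow subgroup `P` exists by Schur–Zassenhaus. It commutes with `P`
by the Engel condition, and with itself since its commutators lie in `G' ⊓ A ≤ P ⊓ A = 1`. -/
theorem exists_central_complement_of_isEngelGroup {G : Type*} [Group G] [Finite G] {p : ℕ}
    [Fact p.Prime] (hE : IsEngelGroup G)
    (P : Sylow p G) [(P : Subgroup G).Normal] (hP : commutator G ≤ P) :
    ∃ A : Subgroup G, A ≤ Subgroup.center G ∧
      (P : Subgroup G) ⊓ A = ⊥ ∧ (P : Subgroup G) ⊔ A = ⊤ := by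
  obtain ⟨A, hA⟩ := Subgroup.exists_right_complement'_of_coprime P.card_coprime_index
  have hbot : (P : Subgroup G) ⊓ A = ⊥ := hA.disjoint.eq_bot
  refine ⟨A, fun a ha => ?_, hbot, hA.sup_eq_top⟩
  rw [Subgroup.mem_center_iff]
  intro g
  obtain ⟨s, hs, b, hb, rfl⟩ := Subgroup.mem_sup_of_normal_left.mp
    (hA.sup_eq_top ▸ Subgroup.mem_top g)
  have hcop : p.Coprime (orderOf a) := by
    rw [(Fact.out : p.Prime).coprime_iff_not_dvd]
    intro h
    apply P.not_dvd_index
    rw [hA.symm.index_eq_card]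
    exact h.trans (A.orderOf_dvd_natCard ha)
  have hsa : Commute s a := hE.commute_of_mem_normal_of_coprime P.2 hs hcop
  have hba : Commute b a := by
    rw [← commutatorElement_eq_one_iff_commute, ← Subgroup.mem_bot, ← hbot]
    refine ⟨hP ?_, ?_⟩
    · rw [commutator_def]
      exact Subgroup.commutator_mem_commutator (Subgroup.mem_top _) (Subgroup.mem_top _)
    · exact A.mul_mem (A.mul_mem (A.mul_mem hb ha) (A.inv_mem hb)) (A.inv_mem ha)
  exact (hsa.mul_left hba).eq

end Engel

/-! ### Finite rings with Engel unit group -/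

section Ring

set_option linter.unusedSimpArgs false in
/-- A ring containing `2 × 2` matrix units `a = e₁₂`, `b = e₂₁`, and in which `2` is zero or is not
nilpotent on `a`, has a non-Engel unit group: it contains a dihedral relation `y⁻¹ x y = x⁻¹` with
`x` not of order a power of two. -/
theorem not_isEngelGroup_units_of_matrixUnits {R : Type*} [Ring R] {a b : R}
    (ha : a * a = 0) (hb : b * b = 0) (haba : a * b * a = a) (hbab : b * a * b = b) (ha0 : a ≠ 0)
    (h2 : (2 : R) = 0 ∨ ∀ n : ℕ, (2 : R) ^ n * a ≠ 0) : ¬ IsEngelGroup Rˣ := by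
  intro hE
  have ha' : ∀ c, a * (a * c) = 0 := fun c => by rw [← mul_assoc, ha, zero_mul]
  have hb' : ∀ c, b * (b * c) = 0 := fun c => by rw [← mul_assoc, hb, zero_mul]
  have haba1 : a * (b * a) = a := by rw [← mul_assoc, haba]
  have hbab1 : b * (a * b) = b := by rw [← mul_assoc, hbab]
  have haba' : ∀ c, a * (b * (a * c)) = a * c := fun c => by
    rw [← mul_assoc, ← mul_assoc, haba]
  have hbab' : ∀ c, b * (a * (b * c)) = b * c := fun c => by
    rw [← mul_assoc, ← mul_assoc, hbab]
  rcases h2 with h2 | h2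
  · -- In characteristic two, `x` has order three and the involution `y` swaps the two coordinates.
    have : Nontrivial R := ⟨a, 0, ha0⟩
    have : CharP R 2 := (CharP.charP_iff_prime_eq_zero Nat.prime_two).mpr (by exact_mod_cast h2)
    let x : Rˣ := ⟨1 + a * b + a + b, 1 + b * a + a + b, by
        simp [mul_add, add_mul, mul_assoc, ha, hb, ha', hb', haba1, hbab1, haba', hbab']; grind, by
        simp [mul_add, add_mul, mul_assoc, ha, hb, ha', hb', haba1, hbab1, haba', hbab']; grind⟩
    have hy : (1 + a * b + b * a + a + b) * (1 + a * b + b * a + a + b) = 1 := by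
        simp [mul_add, add_mul, mul_assoc, ha, hb, ha', hb', haba1, hbab1, haba', hbab']; grind
    let y : Rˣ := ⟨_, _, hy, hy⟩
    have hxy : y⁻¹ * x * y = x⁻¹ := by
      ext
      change (1 + a * b + b * a + a + b) * (1 + a * b + a + b) * (1 + a * b + b * a + a + b)
        = 1 + b * a + a + b
      simp [mul_add, add_mul, mul_assoc, ha, hb, ha', hb', haba1, hbab1, haba', hbab']; grind
    have hx2 : x * x = x⁻¹ := by
      ext
      change (1 + a * b + a + b) * (1 + a * b + a + b) = 1 + b * a + a + b
      simp [mul_add, add_mul, mul_assoc, ha, hb, ha', hb', haba1, hbab1, haba', hbab']; grind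
    have hx3 : x ^ 3 = 1 := by rw [pow_succ, pow_two, hx2, inv_mul_cancel]
    obtain ⟨n, hn⟩ := hE.exists_pow_two_pow_eq_one hxy
    have hx1 : x = 1 := by
      rw [← orderOf_eq_one_iff]
      exact Nat.eq_one_of_dvd_coprimes (Nat.Coprime.pow_right n (by norm_num : Nat.Coprime 3 2))
        (orderOf_dvd_of_pow_eq_one hx3) (orderOf_dvd_of_pow_eq_one hn)
    have h : 1 + a * b + a + b = 1 := congrArg Units.val hx1
    apply ha0
    have h' : a * (1 + a * b + a + b) * a = a * 1 * a := by rw [h]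
    simpa [mul_add, add_mul, mul_assoc, ha, ha', haba1] using h'
  · -- Otherwise `x` is the transvection `1 + e₁₂`, inverted by `y = 1 - 2 e₁₁`.
    have hx : (1 + a) * (1 - a) = 1 ∧ (1 - a) * (1 + a) = 1 := by
      constructor <;> simp [mul_add, add_mul, mul_sub, sub_mul, ha]
    let x : Rˣ := ⟨1 + a, 1 - a, hx.1, hx.2⟩
    have hy : (1 - a * b - a * b) * (1 - a * b - a * b) = 1 := by
      simp only [mul_sub, sub_mul, mul_one, one_mul, mul_assoc, haba']
      abel
    let y : Rˣ := ⟨_, _, hy, hy⟩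
    have hxy : y⁻¹ * x * y = x⁻¹ := by
      ext
      change (1 - a * b - a * b) * (1 + a) * (1 - a * b - a * b) = 1 - a
      simp only [mul_sub, sub_mul, mul_add, add_mul, mul_one, one_mul, mul_assoc, haba', haba1,
        ha']
      abel
    obtain ⟨n, hn⟩ := hE.exists_pow_two_pow_eq_one hxy
    have key : ∀ n : ℕ, (1 + a) ^ 2 ^ n = 1 + (2 : R) ^ n * a := by
      intro n
      induction n with
      | zero => simp
      | succ n ih =>
        have hc : a * ((2 : R) ^ n * a) = 0 := by
          rw [← mul_assoc, ((Commute.ofNat_right a 2).pow_right n).eq, mul_assoc, ha, mul_zero]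
        rw [pow_succ 2 n, pow_mul, ih, pow_two, pow_succ' (2 : R)]
        simp only [mul_add, add_mul, mul_one, one_mul, mul_assoc, hc, mul_zero, two_mul]
        abel
    have h : (1 + a) ^ 2 ^ n = 1 := by simpa [x] using congrArg Units.val hn
    rw [key] at h
    exact h2 n (by simpa using h)

theorem subsingleton_of_isEngelGroup_units_matrix {D ι : Type*} [DivisionRing D] [Fintype ι]
    [DecidableEq ι] (h : IsEngelGroup (Matrix ι ι D)ˣ) : Subsingleton ι := by
  by_contra hι
  rw [not_subsingleton_iff_nontrivial] at hι
  obtain ⟨i, j, hij⟩ := exists_pair_ne ι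
  refine not_isEngelGroup_units_of_matrixUnits (a := Matrix.single i j (1 : D))
    (b := Matrix.single j i (1 : D)) ?_ ?_ ?_ ?_ ?_ ?_ h
  · simp [hij.symm]
  · simp [hij]
  · simp
  · simp
  · intro h0
    simpa using congrFun (congrFun h0 i) j
  · by_cases h2 : (2 : D) = 0
    · left
      rw [← map_ofNat (Matrix.scalar ι) 2, h2, map_zero]
    · right
      intro n h0
      rw [← map_ofNat (Matrix.scalar ι) 2, ← map_pow] at h0
      have := congrFun (congrFun h0 i) j
      simp [Matrix.scalar_apply] at this
      exact h2 this.1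

/-- By Wedderburn–Artin the ring is a product of matrix rings over finite division rings; the
Engel condition leaves only `1 × 1` matrices, and finite division rings are commutative. -/
theorem mul_comm_of_isEngelGroup_units_of_isSemisimpleRing {R : Type*} [Ring R] [Finite R]
    [IsSemisimpleRing R] (h : IsEngelGroup Rˣ) (x y : R) : x * y = y * x := by
  obtain ⟨n, D, d, _, _, ⟨e⟩⟩ := IsSemisimpleRing.exists_ringEquiv_pi_matrix_divisionRing R
  have : Finite (Π i, Matrix (Fin (d i)) (Fin (d i)) (D i)) := Finite.of_equiv R e
  apply e.injective
  rw [map_mul, map_mul]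
  funext i
  let E := MulEquiv.piUnits.toMonoidHom.comp (Units.mapEquiv e.toMulEquiv).toMonoidHom
  have hE : Function.Surjective E :=
    (MulEquiv.piUnits.surjective).comp (Units.mapEquiv e.toMulEquiv).surjective
  have hi : IsEngelGroup (Matrix (Fin (d i)) (Fin (d i)) (D i))ˣ :=
    h.of_surjective ((Pi.evalMonoidHom _ i).comp E) ((Function.surjective_eval i).comp hE)
  have := subsingleton_of_isEngelGroup_units_matrix hi
  have : Finite (Matrix (Fin (d i)) (Fin (d i)) (D i)) :=
    Finite.of_surjective (fun f : Π i, Matrix (Fin (d i)) (Fin (d i)) (D i) => f i)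
      (Function.surjective_eval i)
  have : Finite (D i) := Finite.of_injective (Matrix.scalar (Fin (d i)))
    fun _ _ h => Matrix.scalar_inj.mp h
  ext k l
  obtain rfl := Subsingleton.elim k l
  rw [Pi.mul_apply, Pi.mul_apply, Matrix.mul_apply, Matrix.mul_apply, Fintype.sum_subsingleton _ k,
    Fintype.sum_subsingleton _ k]
  exact (littleWedderburn (D i)).mul_comm _ _

theorem isReduced_of_isSemisimpleRing_of_mul_comm {S : Type*} [Ring S] [IsSemisimpleRing S]
    (h : ∀ x y : S, x * y = y * x) : IsReduced S :=
  let _ : CommRing S := { ‹Ring S› with mul_comm := h }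
  @instIsReducedOfIsSemisimpleRing S _ ‹IsSemisimpleRing S›

theorem Ring.isNilpotent_of_mem_jacobson {R : Type*} [Ring R] [IsArtinianRing R] {x : R}
    (hx : x ∈ Ring.jacobson R) : IsNilpotent x := by
  obtain ⟨n, hn⟩ := IsSemiprimaryRing.isNilpotent (R := R)
  exact ⟨n, by simpa [hn] using Ideal.pow_mem_pow hx n⟩

theorem Units.map_mk_jacobson_surjective (R : Type*) [Ring R] [IsArtinianRing R] :
    Function.Surjective
      (Units.map (Ideal.Quotient.mk (Ring.jacobson R) : R →* R ⧸ Ring.jacobson R)) := by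
  have key : ∀ a b : R, Ideal.Quotient.mk (Ring.jacobson R) (a * b) = 1 → IsUnit (a * b) := by
    intro a b h
    rw [← map_one (Ideal.Quotient.mk (Ring.jacobson R)), Ideal.Quotient.eq] at h
    simpa using (Ring.isNilpotent_of_mem_jacobson h).isUnit_one_add
  intro u
  obtain ⟨a, ha⟩ := Ideal.Quotient.mk_surjective (u : R ⧸ Ring.jacobson R)
  obtain ⟨b, hb⟩ := Ideal.Quotient.mk_surjective
    ((u⁻¹ : (R ⧸ Ring.jacobson R)ˣ) : R ⧸ Ring.jacobson R)
  have h1 : IsUnit (a * b) := key a b (by rw [map_mul, ha, hb, Units.mul_inv])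
  have h2 : IsUnit (b * a) := key b a (by rw [map_mul, ha, hb, Units.inv_mul])
  obtain ⟨c, hc⟩ := h1.exists_right_inv
  obtain ⟨d, hd⟩ := h2.exists_left_inv
  have hu : IsUnit a := isUnit_iff_exists_and_exists.mpr
    ⟨⟨b * c, by rw [← mul_assoc, hc]⟩, ⟨d * b, by rw [mul_assoc, hd]⟩⟩
  exact ⟨hu.unit, Units.ext ha⟩

theorem mk_jacobson_commute_of_isEngelGroup_units {R : Type*} [Ring R] [Finite R]
    (h : IsEngelGroup Rˣ) (x y : R ⧸ Ring.jacobson R) : x * y = y * x :=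
  have : Finite (R ⧸ Ring.jacobson R) := Finite.of_surjective _ Ideal.Quotient.mk_surjective
  mul_comm_of_isEngelGroup_units_of_isSemisimpleRing
    (h.of_surjective _ (Units.map_mk_jacobson_surjective R)) x y

end Ring

/-! ### Group algebras with finitely many nilpotent elements -/

section GroupAlgebra

open MonoidAlgebra

variable {F G : Type*} [Field F] [Group G]

theorem finite_field_of_finite_nilpotents
    (hfin : {x : MonoidAlgebra F G | IsNilpotent x ∧ x ≠ 0}.Finite)
    (hne : {x : MonoidAlgebra F G | IsNilpotent x ∧ x ≠ 0}.Nonempty) : Finite F := by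
  obtain ⟨x, hx, hx0⟩ := hne
  have : Finite {x : MonoidAlgebra F G | IsNilpotent x ∧ x ≠ 0} := hfin
  rw [← not_infinite_iff_finite]
  intro hF
  have : Infinite Fˣ := by
    by_contra h
    rw [not_infinite_iff_finite] at h
    have : Finite F := Finite.of_finite_univ <|
      ((Set.finite_range (Units.val : Fˣ → F)).insert 0).subset fun a _ => by
        by_cases ha : a = 0
        · exact Or.inl ha
        · exact Or.inr ⟨Units.mk0 a ha, rfl⟩
    exact not_finite F
  refine not_injective_infinite_finite (fun a : Fˣ =>
    (⟨(a : F) • x, hx.smul _, smul_ne_zero a.ne_zero hx0⟩ :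
      {x : MonoidAlgebra F G | IsNilpotent x ∧ x ≠ 0})) ?_
  intro a b hab
  exact Units.ext (smul_left_injective F hx0 (congrArg Subtype.val hab))

/-- Fix a nilpotent `x ≠ 0`. If `G` is infinite, infinitely many `g` give the same conjugate
`g x g⁻¹`; they lie in a coset `g₀ C` of the centralizer `C` of `x`. All `c x` with `c ∈ C` are
nilpotent, so infinitely many of these coincide, which the finite support of `x` forbids. -/
theorem finite_group_of_finite_nilpotents
    (hfin : {x : MonoidAlgebra F G | IsNilpotent x ∧ x ≠ 0}.Finite)
    (hne : {x : MonoidAlgebra F G | IsNilpotent x ∧ x ≠ 0}.Nonempty) : Finite G := by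
  obtain ⟨x, hx, hx0⟩ := hne
  have : Finite {x : MonoidAlgebra F G | IsNilpotent x ∧ x ≠ 0} := hfin
  rw [← not_infinite_iff_finite]
  intro hG
  have hinv : ∀ g : G, of F G g⁻¹ * of F G g = 1 := fun g => by
    rw [← map_mul]; simp [one_def]
  have hinv' : ∀ g : G, of F G g * of F G g⁻¹ = 1 := fun g => by
    rw [← map_mul]; simp [one_def]
  have hconj : ∀ g : G, IsNilpotent (of F G g * x * of F G g⁻¹) ∧
      of F G g * x * of F G g⁻¹ ≠ 0 := by
    intro g
    constructor
    · obtain ⟨n, hn⟩ := hx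
      refine ⟨n, ?_⟩
      have key : ∀ m : ℕ, (of F G g * x * of F G g⁻¹) ^ m = of F G g * x ^ m * of F G g⁻¹ := by
        intro m
        induction m with
        | zero => rw [pow_zero, pow_zero, mul_one, hinv']
        | succ m ih =>
          rw [pow_succ, ih]
          calc of F G g * x ^ m * of F G g⁻¹ * (of F G g * x * of F G g⁻¹)
              = of F G g * x ^ m * (of F G g⁻¹ * of F G g) * x * of F G g⁻¹ := by
                simp only [mul_assoc]
            _ = _ := by rw [hinv, mul_one, pow_succ]; simp only [mul_assoc]
      rw [key, hn, mul_zero, zero_mul]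
    · intro h
      apply hx0
      calc x = (of F G g⁻¹ * of F G g) * x * (of F G g⁻¹ * of F G g) := by
            rw [hinv, one_mul, mul_one]
        _ = of F G g⁻¹ * (of F G g * x * of F G g⁻¹) * of F G g := by simp only [mul_assoc]
        _ = 0 := by rw [h, mul_zero, zero_mul]
  obtain ⟨y, hy⟩ := Finite.exists_infinite_fiber (fun g : G =>
    (⟨_, hconj g⟩ : {x : MonoidAlgebra F G | IsNilpotent x ∧ x ≠ 0}))
  set T := (fun g : G =>
    (⟨_, hconj g⟩ : {x : MonoidAlgebra F G | IsNilpotent x ∧ x ≠ 0})) ⁻¹' {y}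
  have hgx : ∀ g : T, of F G g * x = y.1 * of F G g := by
    rintro ⟨g, hg⟩
    have hg' : of F G g * x * of F G g⁻¹ = y.1 := congrArg Subtype.val hg
    rw [← hg', mul_assoc _ _ (of F G g), hinv, mul_one]
  obtain ⟨g₀⟩ : Nonempty T := inferInstance
  have hcomm : ∀ g : T, Commute (of F G (g₀.1⁻¹ * g)) x := by
    intro g
    change of F G (g₀.1⁻¹ * g) * x = x * of F G (g₀.1⁻¹ * g)
    have h0 : of F G g₀.1⁻¹ * y.1 = x * of F G g₀.1⁻¹ := by
      calc of F G g₀.1⁻¹ * y.1 = of F G g₀.1⁻¹ * (y.1 * of F G g₀.1) * of F G g₀.1⁻¹ := by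
            rw [mul_assoc, mul_assoc, hinv', mul_one]
        _ = (of F G g₀.1⁻¹ * of F G g₀.1) * x * of F G g₀.1⁻¹ := by
            rw [← hgx]; simp only [mul_assoc]
        _ = _ := by rw [hinv, one_mul]
    rw [map_mul, mul_assoc, hgx, ← mul_assoc, h0, mul_assoc]
  have hnil : ∀ g : T, IsNilpotent (of F G (g₀.1⁻¹ * g) * x) ∧ of F G (g₀.1⁻¹ * g) * x ≠ 0 := by
    intro g
    refine ⟨(hcomm g).isNilpotent_mul_left hx, fun h => hx0 ?_⟩
    rw [← one_mul x, ← hinv (g₀.1⁻¹ * g), mul_assoc, h, mul_zero]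
  obtain ⟨z, hz⟩ := Finite.exists_infinite_fiber (fun g : T =>
    (⟨_, hnil g⟩ : {x : MonoidAlgebra F G | IsNilpotent x ∧ x ≠ 0}))
  obtain ⟨s, hs⟩ : ∃ s, x.coeff s ≠ 0 := by
    by_contra! h
    exact hx0 (by ext s; simpa using h s)
  refine not_injective_infinite_finite (β := z.1.coeff.support) (fun g : ((fun g : T =>
    (⟨_, hnil g⟩ : {x : MonoidAlgebra F G | IsNilpotent x ∧ x ≠ 0})) ⁻¹' {z}) =>
      ⟨g₀.1⁻¹ * g.1.1 * s, ?_⟩) ?_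
  · have : of F G (g₀.1⁻¹ * g.1.1) * x = z.1 := congrArg Subtype.val g.2
    rw [Finsupp.mem_support_iff, ← this, of_apply, coeff_single_mul_apply]
    simpa [mul_assoc] using hs
  · intro g h hgh
    have := congrArg Subtype.val hgh
    exact Subtype.ext (Subtype.ext (by simpa using this))

/-! ### The group algebra modulo its Jacobson radical -/

/-- Every unit is a normalized unit times a nonzero scalar, and scalars are central. -/
theorem isEngelGroup_units_of_normalizedUnits (h : IsEngelGroup (normalizedUnits F G)) :
    IsEngelGroup (MonoidAlgebra F G)ˣ := by
  refine h.of_forall_mul_center fun u => ?_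
  set l := Units.map (augmentation F G : MonoidAlgebra F G →* F) u with hl
  refine ⟨Units.map (algebraMap F (MonoidAlgebra F G) : F →* MonoidAlgebra F G) l⁻¹, ?_, ?_⟩
  · rw [Subgroup.mem_center_iff]
    intro v
    ext1
    exact (Algebra.commutes _ _).symm
  · have : Units.map (augmentation F G : MonoidAlgebra F G →* F)
        (Units.map (algebraMap F (MonoidAlgebra F G) : F →* MonoidAlgebra F G) l⁻¹) = l⁻¹ := by
      ext1
      exact (augmentation F G).commutes _
    rw [normalizedUnits, MonoidHom.mem_ker, map_mul, this, ← hl, mul_inv_cancel]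

variable (F G) in
theorem MonoidAlgebra.charP (p : ℕ) [CharP F p] : CharP (MonoidAlgebra F G) p :=
  charP_of_injective_algebraMap (algebraMap F (MonoidAlgebra F G)).injective p

theorem MonoidAlgebra.finite (F G : Type*) [Field F] [Finite F] [Finite G] :
    Finite (MonoidAlgebra F G) :=
  Module.finite_of_finite F

section Jacobson

variable (F G) in
/-- The homomorphism from `G` to the multiplicative monoid of the quotient of `F[G]` by its
Jacobson radical `J`; its kernel consists of the `g` with `g - 1 ∈ J`. -/
noncomputable def toQuotientJacobson :
    G →* MonoidAlgebra F G ⧸ Ring.jacobson (MonoidAlgebra F G) :=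
  (Ideal.Quotient.mk (Ring.jacobson (MonoidAlgebra F G)) :
    MonoidAlgebra F G →* MonoidAlgebra F G ⧸ Ring.jacobson (MonoidAlgebra F G)).comp (of F G)

theorem mem_ker_toQuotientJacobson {g : G} :
    g ∈ (toQuotientJacobson F G).ker ↔ of F G g - 1 ∈ Ring.jacobson (MonoidAlgebra F G) := by
  rw [MonoidHom.mem_ker, ← Ideal.Quotient.eq, map_one]
  rfl

theorem commutator_le_ker_toQuotientJacobson
    (hc : ∀ x y : MonoidAlgebra F G ⧸ Ring.jacobson (MonoidAlgebra F G), x * y = y * x) :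
    commutator G ≤ (toQuotientJacobson F G).ker := by
  rw [commutator_def, Subgroup.commutator_le]
  intro g _ h _
  rw [MonoidHom.mem_ker, commutatorElement_def, mul_assoc, map_mul, map_mul,
    hc (toQuotientJacobson F G g), ← map_mul, ← map_mul]
  simp

variable {p : ℕ} [Fact p.Prime] [CharP F p]

theorem of_sub_one_pow (g : G) (k : ℕ) :
    (of F G g - 1) ^ p ^ k = of F G (g ^ p ^ k) - 1 := by
  have := MonoidAlgebra.charP F G p
  rw [sub_pow_char_pow_of_commute _ _ (Commute.one_right _), one_pow, map_pow]

/-- If `p` does not divide the order of `G`, then `F[G]` is semisimple by Maschke's theorem, and a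
commutative semisimple ring is reduced. -/
theorem isReduced_of_sylow_eq_bot [Finite G] {P : Sylow p G} (hP : (P : Subgroup G) = ⊥)
    (hc : ∀ g h : G, g * h = h * g) : IsReduced (MonoidAlgebra F G) := by
  have : NeZero (Nat.card G : F) := by
    refine ⟨fun h => P.not_dvd_index ?_⟩
    rw [hP, Subgroup.index_bot]
    exact (CharP.cast_eq_zero_iff F p _).mp h
  let _ : CommGroup G := { ‹Group G› with mul_comm := hc }
  exact isReduced_of_isSemisimpleRing_of_mul_comm (fun x y => mul_comm x y)

variable [Finite F] [Finite G]

/-- If `F[G] / J` is commutative, the kernel of `G → F[G] / J` is the only Sylow `p`-subgroup: it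
is a `p`-group since `J` is nilpotent, and it contains every `p`-element since `F[G] / J` has no
nilpotent elements. -/
theorem sylow_eq_ker_toQuotientJacobson
    (hc : ∀ x y : MonoidAlgebra F G ⧸ Ring.jacobson (MonoidAlgebra F G), x * y = y * x)
    (P : Sylow p G) : (P : Subgroup G) = (toQuotientJacobson F G).ker := by
  have := MonoidAlgebra.finite F G
  have hK : IsPGroup p (toQuotientJacobson F G).ker := by
    rintro ⟨g, hg⟩
    rw [mem_ker_toQuotientJacobson] at hg
    obtain ⟨n, hn⟩ := Ring.isNilpotent_of_mem_jacobson hg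
    have h0 : (of F G g - 1) ^ p ^ n = 0 :=
      pow_eq_zero_of_le (Nat.lt_pow_self (Fact.out : p.Prime).one_lt).le hn
    rw [of_sub_one_pow, sub_eq_zero, ← map_one (of F G)] at h0
    exact ⟨n, Subtype.ext (of_injective h0)⟩
  refine (P.3 hK fun g hg => ?_).symm
  obtain ⟨k, hk⟩ := P.2 ⟨g, hg⟩
  have hk' : g ^ p ^ k = 1 := congrArg Subtype.val hk
  have h0 : (of F G g - 1) ^ p ^ k = 0 := by rw [of_sub_one_pow, hk', map_one, sub_self]
  have := isReduced_of_isSemisimpleRing_of_mul_comm hc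
  have hn : IsNilpotent (Ideal.Quotient.mk (Ring.jacobson (MonoidAlgebra F G)) (of F G g - 1)) :=
    IsNilpotent.map ⟨_, h0⟩ _
  exact mem_ker_toQuotientJacobson.mpr (Ideal.Quotient.eq_zero_iff_mem.mp hn.eq_zero)

/-- If `G = P A` with `P ⊆ 1 + J` and `A` central, then `F[G] = F[A] + J` with `F[A]` central;
since `J` is nil, a power `u ^ p ^ k` of any `u` is central by the binomial theorem in
characteristic `p`. -/
theorem exists_pow_mem_center {A : Subgroup G} (hA : A ≤ Subgroup.center G)
    (h : (toQuotientJacobson F G).ker ⊔ A = ⊤) (u : MonoidAlgebra F G) :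
    ∃ k : ℕ, ∀ v, Commute (u ^ p ^ k) v := by
  have := MonoidAlgebra.finite F G
  have hdec : ∃ c : MonoidAlgebra F G,
      (∀ v, Commute c v) ∧ u - c ∈ Ring.jacobson (MonoidAlgebra F G) := by
    induction u using MonoidAlgebra.induction_linear with
    | zero => exact ⟨0, fun v => Commute.zero_left v, by simp⟩
    | add x y hx hy =>
      obtain ⟨c, hc, hxc⟩ := hx
      obtain ⟨d, hd, hyd⟩ := hy
      exact ⟨c + d, fun v => (hc v).add_left (hd v), by
        rw [add_sub_add_comm]; exact add_mem hxc hyd⟩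
    | single g r =>
      obtain ⟨s, hs, a, ha, rfl⟩ := Subgroup.mem_sup_of_normal_left.mp (h ▸ Subgroup.mem_top g)
      refine ⟨r • of F G a, fun v => ((of_commute (fun g => ?_) v).smul_left r), ?_⟩
      · exact (Subgroup.mem_center_iff.mp (hA ha) g).symm
      · have : single (s * a) r - r • of F G a = (of F G s - 1) * (r • of F G a) := by
          rw [sub_mul, one_mul, mul_smul_comm, ← map_mul, of_apply, of_apply, smul_single,
            smul_single, smul_eq_mul, mul_one]
        rw [this]
        exact Ideal.IsTwoSided.mul_mem_of_left _ (mem_ker_toQuotientJacobson.mp hs)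
  obtain ⟨c, hc, hu⟩ := hdec
  obtain ⟨n, hn⟩ := Ring.isNilpotent_of_mem_jacobson hu
  have h0 : (u - c) ^ p ^ n = 0 :=
    pow_eq_zero_of_le (Nat.lt_pow_self (Fact.out : p.Prime).one_lt).le hn
  have := MonoidAlgebra.charP F G p
  rw [sub_pow_char_pow_of_commute _ _ (hc u).symm, sub_eq_zero] at h0
  exact ⟨n, fun v => h0 ▸ (hc v).pow_left _⟩

theorem isNilpotent_normalizedUnits (p : ℕ) [Fact p.Prime] [CharP F p] {A : Subgroup G}
    (hA : A ≤ Subgroup.center G) (h : (toQuotientJacobson F G).ker ⊔ A = ⊤) :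
    Group.IsNilpotent (normalizedUnits F G) := by
  have := MonoidAlgebra.finite F G
  have hp : IsPGroup p (normalizedUnits F G ⧸ Subgroup.center (normalizedUnits F G)) := by
    intro q
    obtain ⟨u, rfl⟩ := QuotientGroup.mk_surjective q
    obtain ⟨k, hk⟩ := exists_pow_mem_center (p := p) hA h (u : (MonoidAlgebra F G)ˣ)
    refine ⟨k, ?_⟩
    rw [← QuotientGroup.mk_pow, QuotientGroup.eq_one_iff, Subgroup.mem_center_iff]
    intro v
    apply Subtype.ext
    apply Units.ext
    exact ((hk v.1.1).eq).symm
  exact Group.of_quotient_center_nilpotent hp.isNilpotent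

end Jacobson

end GroupAlgebra

theorem theorem1 {F G : Type*} [Field F] [Group G] (p : ℕ) [CharP F p]
    (hfin : {x : MonoidAlgebra F G | IsNilpotent x ∧ x ≠ 0}.Finite)
    (hne : {x : MonoidAlgebra F G | IsNilpotent x ∧ x ≠ 0}.Nonempty) :
    Finite F ∧ p.Prime ∧
      (IsEngelGroup (normalizedUnits F G) →
        Group.IsNilpotent (normalizedUnits F G) ∧
        Finite G ∧
        ∀ P : Sylow p G,
          (P : Subgroup G) ≠ ⊥ ∧
          (P : Subgroup G).Normal ∧
          commutator G ≤ (P : Subgroup G) ∧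
          ∃ A : Subgroup G, A ≤ Subgroup.center G ∧
            (P : Subgroup G) ⊓ A = ⊥ ∧ (P : Subgroup G) ⊔ A = ⊤) := by
  have hF := finite_field_of_finite_nilpotents hfin hne
  have hG := finite_group_of_finite_nilpotents hfin hne
  have hp : p.Prime := CharP.char_is_prime F p
  have := Fact.mk hp
  refine ⟨hF, hp, fun hV => ?_⟩
  have hU := isEngelGroup_units_of_normalizedUnits hV
  have hEG : IsEngelGroup G := hU.of_injective (MonoidAlgebra.of F G).toHomUnits
    fun g h hgh => MonoidAlgebra.of_injective (congrArg Units.val hgh)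
  have := MonoidAlgebra.finite F G
  have hc := mk_jacobson_commute_of_isEngelGroup_units hU
  have main : ∀ P : Sylow p G, (P : Subgroup G).Normal ∧ commutator G ≤ (P : Subgroup G) ∧
      ∃ A : Subgroup G, A ≤ Subgroup.center G ∧
        (P : Subgroup G) ⊓ A = ⊥ ∧ (P : Subgroup G) ⊔ A = ⊤ := by
    intro P
    have hP := sylow_eq_ker_toQuotientJacobson hc P
    have hn : (P : Subgroup G).Normal := hP ▸ MonoidHom.normal_ker _
    have hcomm : commutator G ≤ (P : Subgroup G) :=
      hP ▸ commutator_le_ker_toQuotientJacobson hc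
    exact ⟨hn, hcomm, exists_central_complement_of_isEngelGroup hEG P hcomm⟩
  refine ⟨?_, hG, fun P => ⟨fun hbot => ?_, main P⟩⟩
  · obtain ⟨P⟩ : Nonempty (Sylow p G) := inferInstance
    obtain ⟨-, -, A, hA, -, hsup⟩ := main P
    rw [sylow_eq_ker_toQuotientJacobson hc P] at hsup
    exact isNilpotent_normalizedUnits p hA hsup
  · obtain ⟨x, hx, hx0⟩ := hne
    have hab : ∀ g h : G, g * h = h * g := by
      intro g h
      rw [← commutatorElement_eq_one_iff_mul_comm, ← Subgroup.mem_bot, ← hbot]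
      apply (main P).2.1
      rw [commutator_def]
      exact Subgroup.commutator_mem_commutator (Subgroup.mem_top _) (Subgroup.mem_top _)
    have := isReduced_of_sylow_eq_bot (F := F) hbot hab
    exact hx0 hx.eq_zero
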